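/- For $\beta>0$ let $\phi_\beta(z)=e^{\beta(\sqrt{1-z^2}-1)}$ for $|z|\le 1$ and $\phi_\beta(z)=0$ otherwise (the "exponential of semicircle" kernel), and write $\hat f(k)=\int_{-\infty}^{\infty} f(x)e^{ikx}\,dx$. Fix an integer $N\ge 1$ (the number of modes of the one-dimensional type 1 or type 2 nonuniform FFT), an upsampling factor $\sigma>1$ (hence the upsampled grid size $n=\sigma N$) and a safety factor $\gamma\in(0,1)$ such that $$1-\frac1\sigma-\frac{\gamma^{-2}-1}{4\sigma^2}\ \ge\ 0 .$$ For a kernel width $w>0$ put $\beta=\gamma\pi w\left(1-\frac1{2\sigma}\right)$, $\alpha=\pi w/n$ and $\psi(x)=\phi_\beta(x/\alpha)$. For integers $|k|\le N/2$ and real $x$ let $$S_k(x)=\sum_{m\ne0}\hat\psi(k+mn)\,e^{i(k+mn)x},\qquad g_k(x)=\frac{S_k(x)}{\hat\psi(k)},$$ where the sum is the limit of the sums over $0<|m|\le M$ as $M\to\infty$; this limit exists for all such $k$, $x$, $w$. Then for all sufficiently large $w$ one has $\hat\psi(k)\neq0$ for all integers $|k|\le N/2$, and the aliasing error $$\varepsilon_\infty:=\max_{|k|\le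 N/2}\ \sup_{x\in\mathbb R}|g_k(x)|\ \le\ \frac{\max_{|k|\le N/2}\,\sup_{x\in\mathbb R}|S_k(x)|}{\min_{|k|\le N/2}|\hat\psi(k)|}<\infty .$$ Both $\varepsilon_\infty$ and the right-hand bound are $$O\!\left(\sqrt w\;\exp\!\left(-\pi w\gamma\sqrt{1-\frac1\sigma-\frac{\gamma^{-2}-1}{4\sigma^2}}\right)\right)\qquad (w\to\infty),$$ with implied constants that may depend on $N$, $\sigma$, $\gamma$. -/

import Mathlib

open Filter Topology Asymptotics

noncomputable section

/-- The exponential of semicircle (ES) kernel with parameter `β`, supported on `[-1, 1]`. -/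
def esKernel (β z : ℝ) : ℝ :=
  if |z| ≤ 1 then Real.exp (β * (Real.sqrt (1 - z ^ 2) - 1)) else 0

/-- The Fourier transform in the convention `f ↦ ∫ f(x) e^{ikx} dx`. -/
def fourierHat (f : ℝ → ℝ) (k : ℝ) : ℂ :=
  ∫ x : ℝ, (f x : ℂ) * Complex.exp (Complex.I * (k : ℂ) * (x : ℂ))

/-- The ES kernel parameter for kernel width `w`, upsampling factor `σ` and safety factor `γ`. -/
def esBeta (σ γ w : ℝ) : ℝ :=
  γ * Real.pi * w * (1 - 1 / (2 * σ))

/-- The kernel `esKernel β` rescaled to have width `w` in units of the spacing `2 * π / n` of the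
upsampled grid of size `n`, that is, to have support `[-α, α]` with `α = π * w / n`. -/
def scaledKernel (β w n x : ℝ) : ℝ :=
  esKernel β (x / (Real.pi * w / n))

/-- The rescaled kernel for `N` modes, upsampled grid size `n = σ * N` and parameter
`β = esBeta σ γ w`. -/
def nufftKernel (N : ℕ) (σ γ w x : ℝ) : ℝ :=
  scaledKernel (esBeta σ γ w) w (σ * N) x

/-- The term of index `m` of the phased sum over the aliased frequencies `k + m * n`, `m ≠ 0`,
where `n = σ * N`. -/
def aliasTerm (N : ℕ) (σ γ w : ℝ) (k : ℤ) (x : ℝ) (m : ℤ) : ℂ :=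
  if m = 0 then 0
  else fourierHat (nufftKernel N σ γ w) ((k : ℝ) + (m : ℝ) * (σ * N)) *
    Complex.exp (Complex.I * (((k : ℝ) + (m : ℝ) * (σ * N) : ℝ) : ℂ) * (x : ℂ))

/-- The phased sum over all `m ≠ 0`. The kernel jumps at the ends of its support, so that the
series converges only conditionally: it is the limit of the sums over `0 < |m| ≤ M`. -/
def aliasSum (N : ℕ) (σ γ w : ℝ) (k : ℤ) (x : ℝ) : ℂ :=
  tsum (aliasTerm N σ γ w k x) (SummationFilter.symmetricIcc ℤ)

/-- The aliasing error function `g_k`. -/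
def aliasError (N : ℕ) (σ γ w : ℝ) (k : ℤ) (x : ℝ) : ℂ :=
  (fourierHat (nufftKernel N σ γ w) (k : ℝ))⁻¹ * aliasSum N σ γ w k x

/-- The frequencies `k` with `|k| ≤ N / 2`. -/
def centralModes (N : ℕ) : Set ℤ :=
  {k : ℤ | |(k : ℝ)| ≤ (N : ℝ) / 2}

/-- The aliasing error `ε_∞`, the largest of the sup norms of the functions `g_k`. -/
def epsInf (N : ℕ) (σ γ w : ℝ) : ENNReal :=
  ⨆ k ∈ centralModes N, ⨆ x : ℝ, ‖aliasError N σ γ w k x‖ₑ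

/-- The upper bound for `ε_∞` in which numerator and denominator of the `g_k` are
estimated separately. -/
def epsBound (N : ℕ) (σ γ w : ℝ) : ENNReal :=
  (⨆ k ∈ centralModes N, ⨆ x : ℝ, ‖aliasSum N σ γ w k x‖ₑ) /
    (⨅ k ∈ centralModes N, ‖fourierHat (nufftKernel N σ γ w) (k : ℝ)‖ₑ)

/-- The rate `√w * exp (-π w γ √(1 - 1/σ - (γ⁻² - 1) / (4σ²)))`. -/
def esRate (σ γ w : ℝ) : ℝ :=
  Real.sqrt w * Real.exp (-(Real.pi * w * γ *
    Real.sqrt (1 - 1 / σ - ((γ ^ 2)⁻¹ - 1) / (4 * σ ^ 2))))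

end

noncomputable section

/-! After the substitution `z = sin θ`, every value of the transform is the common factor
`kernelScale` times `esArc b x`, the integral of `cos t * exp (b cos t + i x sin t)`. The factor
cancels in the error, so only `esArc` matters, with cutoff `|x| = b`. The integrand is entire, so
the segment can be moved up by `i h`; on the vertical sides the exponential has modulus one, so they
contribute only bounded terms.

Below the cutoff, with `tanh h = x / b`, the exponent collapses to `d cos t`, where `d = √(b² -
x²)`. This bounds `esArc` below by `arcMass d`, of size at least `e^d / √w` (`arcMass_le_re_esArc`,
`le_arcMass`). At the outermost modes `|k| = N/2`, `d` is the exponent in the rate.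

The aliased frequencies lie beyond the cutoff by a factor of at least `1 / γ`. There a shift makes
the integrand decay, and nothing exponentially large remains. Since the kernel jumps at `±1`, the
transform decays only like `1 / x`. Integration by parts isolates the jump term `2 sin x / x`; the
rest is `O(|m|^(-3/2))`, hence absolutely summable (`norm_esArc_sub_jump_le`). The jump terms form
sawtooth series, whose symmetric sums converge with a uniform bound
(`exists_hasSum_exp_div_int_add`). So the alias sum is `O(1)` times the common factor, and division
by the lower bound gives the rate. -/

/-- The entire function `e^{b cos z + i x sin z}`. -/
def arcExp (b x : ℝ) (z : ℂ) : ℂ :=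
  Complex.exp (b * Complex.cos z + Complex.I * x * Complex.sin z)

/-- The Fourier transform of `e^{b √(1 - z²)}` on `[-1, 1]`, after the substitution `z = sin θ`. -/
def esArc (b x : ℝ) : ℂ :=
  ∫ t : ℝ in -(Real.pi / 2)..Real.pi / 2, Complex.cos t * arcExp b x t

/-- The companion of `esArc` with weight `sin θ`. -/
def esArcSin (b x : ℝ) : ℂ :=
  ∫ t : ℝ in -(Real.pi / 2)..Real.pi / 2, Complex.sin t * arcExp b x t

/-- The value of `esArc` at frequency `0`, as a real number. -/
def arcMass (d : ℝ) : ℝ :=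
  ∫ t : ℝ in -(Real.pi / 2)..Real.pi / 2, Real.cos t * Real.exp (d * Real.cos t)

/-! ### Reduction of the transform to the arc integral. -/

lemma differentiable_arcExp (b x : ℝ) : Differentiable ℂ (arcExp b x) := by
  unfold arcExp
  fun_prop

lemma continuous_arcExp_ofReal (b x : ℝ) : Continuous fun t : ℝ => arcExp b x t :=
  (differentiable_arcExp b x).continuous.comp Complex.continuous_ofReal

lemma esArc_neg (b x : ℝ) : esArc b (-x) = esArc b x := by
  unfold esArc
  have h := intervalIntegral.integral_comp_neg (a := -(Real.pi / 2)) (b := Real.pi / 2)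
    (fun t : ℝ => Complex.cos t * arcExp b x t)
  rw [neg_neg] at h
  rw [← h]
  congr 1
  ext t
  simp [arcExp]

lemma esArc_abs (b x : ℝ) : esArc b |x| = esArc b x := by
  rcases abs_choice x with h | h <;> rw [h]
  exact esArc_neg b x

/-- The substitution `z = sin θ`. -/
lemma integral_exp_sqrt_eq_esArc (b x : ℝ) :
    ∫ z : ℝ in (-1)..1, (Real.exp (b * Real.sqrt (1 - z ^ 2)) : ℂ) *
      Complex.exp (Complex.I * x * z) = esArc b x := by
  have h := intervalIntegral.integral_deriv_smul_comp (a := -(Real.pi / 2)) (b := Real.pi / 2)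
    (f := Real.sin) (f' := Real.cos)
    (g := fun z : ℝ => (Real.exp (b * Real.sqrt (1 - z ^ 2)) : ℂ) *
      Complex.exp (Complex.I * x * z)) (fun t _ => Real.hasDerivAt_sin t)
    Real.continuous_cos.continuousOn (by fun_prop)
  rw [Real.sin_neg, Real.sin_pi_div_two] at h
  rw [← h]
  unfold esArc
  refine intervalIntegral.integral_congr fun t ht => ?_
  rw [Set.uIcc_of_le (by linarith [Real.pi_pos])] at ht
  have hc : Real.sqrt (1 - Real.sin t ^ 2) = Real.cos t :=
    (Real.cos_eq_sqrt_one_sub_sin_sq ht.1 ht.2).symm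
  simp only [Function.comp_apply, hc, arcExp, Complex.exp_add, Complex.real_smul]
  push_cast
  ring

lemma fourierHat_scaledKernel {b w n : ℝ} (hw : 0 < w) (hn : 0 < n) (k : ℝ) :
    fourierHat (scaledKernel b w n) k =
      ((Real.pi * w / n * Real.exp (-b) : ℝ) : ℂ) * esArc b (Real.pi * w / n * k) := by
  have hα : 0 < Real.pi * w / n := by positivity
  unfold fourierHat scaledKernel
  generalize Real.pi * w / n = α at hα
  have h := MeasureTheory.Measure.integral_comp_div
    (fun z : ℝ => (esKernel b z : ℂ) * Complex.exp (Complex.I * (α * k : ℝ) * z)) α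
  rw [abs_of_pos hα] at h
  have h1 : (fun x : ℝ => (esKernel b (x / α) : ℂ) * Complex.exp (Complex.I * k * x)) =
      fun x : ℝ => (esKernel b (x / α) : ℂ) *
        Complex.exp (Complex.I * (α * k : ℝ) * (x / α : ℝ)) := by
    ext x
    have : (α : ℂ) ≠ 0 := by exact_mod_cast hα.ne'
    congr 2
    push_cast
    field_simp
  rw [h1, h]
  have h2 : (fun z : ℝ => (esKernel b z : ℂ) * Complex.exp (Complex.I * (α * k : ℝ) * z)) =
      (Set.Icc (-1 : ℝ) 1).indicator fun z : ℝ => (Real.exp (-b) : ℂ) *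
        ((Real.exp (b * Real.sqrt (1 - z ^ 2)) : ℂ) *
          Complex.exp (Complex.I * (α * k : ℝ) * z)) := by
    ext z
    by_cases hz : z ∈ Set.Icc (-1 : ℝ) 1
    · rw [Set.indicator_of_mem hz, esKernel, if_pos (abs_le.2 hz), ← mul_assoc,
        ← Complex.ofReal_mul, ← Real.exp_add]
      congr 4
      ring
    · rw [Set.indicator_of_notMem hz, esKernel, if_neg (fun h' => hz (abs_le.1 h'))]
      simp
  rw [h2, MeasureTheory.integral_indicator measurableSet_Icc,
    MeasureTheory.integral_Icc_eq_integral_Ioc,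
    ← intervalIntegral.integral_of_le (by norm_num), intervalIntegral.integral_const_mul,
    integral_exp_sqrt_eq_esArc, Complex.real_smul]
  push_cast
  ring

/-! ### Contour shift and the integrand on the shifted segments. -/

/-- Shifting the interval `[-π/2, π/2]` up by `i h`. -/
lemma integral_arc_shift {F : ℂ → ℂ} (hF : Differentiable ℂ F) (h : ℝ) :
    ∫ t : ℝ in -(Real.pi / 2)..Real.pi / 2, F t =
      (∫ t : ℝ in -(Real.pi / 2)..Real.pi / 2, F (t + h * Complex.I)) -
      Complex.I * (∫ y : ℝ in 0..h, F ((Real.pi / 2 : ℝ) + y * Complex.I)) +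
      Complex.I * (∫ y : ℝ in 0..h, F ((-(Real.pi / 2) : ℝ) + y * Complex.I)) := by
  have := Complex.integral_boundary_rect_eq_zero_of_differentiableOn F
    ((-(Real.pi / 2) : ℝ) : ℂ) (((Real.pi / 2 : ℝ) : ℂ) + h * Complex.I) hF.differentiableOn
  simp only [Complex.add_re, Complex.add_im, Complex.ofReal_re, Complex.ofReal_im,
    Complex.mul_re, Complex.mul_im, Complex.I_re, Complex.I_im, smul_eq_mul, mul_zero, mul_one,
    sub_zero, zero_add, add_zero, Complex.ofReal_zero, zero_mul] at this
  linear_combination this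

lemma sin_pi_div_two_add_mul_I (y : ℝ) :
    Complex.sin ((Real.pi / 2 : ℝ) + y * Complex.I) = Real.cosh y := by
  rw [Complex.sin_add_mul_I]; simp

lemma cos_pi_div_two_add_mul_I (y : ℝ) :
    Complex.cos ((Real.pi / 2 : ℝ) + y * Complex.I) = -(Real.sinh y * Complex.I) := by
  rw [Complex.cos_add_mul_I]; simp

lemma sin_neg_pi_div_two_add_mul_I (y : ℝ) :
    Complex.sin ((-(Real.pi / 2) : ℝ) + y * Complex.I) = -Real.cosh y := by
  rw [Complex.sin_add_mul_I]; simp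

lemma cos_neg_pi_div_two_add_mul_I (y : ℝ) :
    Complex.cos ((-(Real.pi / 2) : ℝ) + y * Complex.I) = Real.sinh y * Complex.I := by
  rw [Complex.cos_add_mul_I]; simp

/-- The sign of `x sinh y - b cosh y` separates growth from decay: it can be made positive with `y >
0` only if `x > b`. On the vertical sides `cos t = 0`, so the modulus is one for every `y`. -/
lemma norm_arcExp_add_mul_I (b x t y : ℝ) :
    ‖arcExp b x (t + y * Complex.I)‖ =
      Real.exp (-(Real.cos t * (x * Real.sinh y - b * Real.cosh y))) := by
  rw [arcExp, Complex.norm_exp, Complex.cos_add_mul_I, Complex.sin_add_mul_I]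
  congr 1
  simp [← Complex.ofReal_cos, ← Complex.ofReal_sin, ← Complex.ofReal_cosh, ← Complex.ofReal_sinh]
  ring

lemma norm_arcExp_pi_div_two (b x y : ℝ) :
    ‖arcExp b x ((Real.pi / 2 : ℝ) + y * Complex.I)‖ = 1 := by
  rw [norm_arcExp_add_mul_I]; simp

lemma norm_arcExp_neg_pi_div_two (b x y : ℝ) :
    ‖arcExp b x ((-(Real.pi / 2) : ℝ) + y * Complex.I)‖ = 1 := by
  rw [norm_arcExp_add_mul_I]; simp

/-! ### Estimates beyond the cutoff. -/

/-- The jump of the kernel at `±1` is split off by integration by parts. -/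
lemma esArc_eq_jump_add (b : ℝ) {x : ℝ} (hx : x ≠ 0) :
    esArc b x = 2 * Real.sin x / x + b / (Complex.I * x) * esArcSin b x := by
  have hd : ∀ t ∈ Set.uIcc (-(Real.pi / 2)) (Real.pi / 2), HasDerivAt (fun t : ℝ => arcExp b x t)
      (Complex.I * x * (Complex.cos t * arcExp b x t) -
        b * (Complex.sin t * arcExp b x t)) t := by
    intro t _
    have h1 : HasDerivAt (arcExp b x)
        (arcExp b x t * (b * (-Complex.sin t) + Complex.I * x * Complex.cos t)) (t : ℂ) := by
      unfold arcExp
      exact (((Complex.hasDerivAt_cos _).const_mul (b : ℂ)).add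
        ((Complex.hasDerivAt_sin _).const_mul (Complex.I * x))).cexp
    convert! h1.comp_ofReal using 1
    ring
  have hc := continuous_arcExp_ofReal b x
  have i1 : IntervalIntegrable (fun t : ℝ => Complex.I * x * (Complex.cos t * arcExp b x t))
      MeasureTheory.volume (-(Real.pi / 2)) (Real.pi / 2) :=
    Continuous.intervalIntegrable (by fun_prop) _ _
  have i2 : IntervalIntegrable (fun t : ℝ => (b : ℂ) * (Complex.sin t * arcExp b x t))
      MeasureTheory.volume (-(Real.pi / 2)) (Real.pi / 2) :=
    Continuous.intervalIntegrable (by fun_prop) _ _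
  have h := intervalIntegral.integral_eq_sub_of_hasDerivAt hd (i1.sub i2)
  rw [intervalIntegral.integral_sub i1 i2, intervalIntegral.integral_const_mul,
    intervalIntegral.integral_const_mul] at h
  change Complex.I * x * esArc b x - b * esArcSin b x = _ at h
  have e : arcExp b x ((Real.pi / 2 : ℝ) : ℂ) - arcExp b x ((-(Real.pi / 2) : ℝ) : ℂ) =
      2 * Complex.I * Real.sin x := by
    unfold arcExp
    rw [← Complex.ofReal_cos, ← Complex.ofReal_sin, ← Complex.ofReal_cos, ← Complex.ofReal_sin,
      Real.cos_neg, Real.sin_neg, Real.cos_pi_div_two, Real.sin_pi_div_two, Complex.ofReal_sin]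
    have h1 := Complex.two_sin (x : ℂ)
    have h2 : (b : ℂ) * ((0 : ℝ) : ℂ) + Complex.I * x * ((1 : ℝ) : ℂ) = x * Complex.I := by
      push_cast; ring
    have h3 : (b : ℂ) * ((0 : ℝ) : ℂ) + Complex.I * x * ((-1 : ℝ) : ℂ) = -x * Complex.I := by
      push_cast; ring
    rw [h2, h3]
    linear_combination (-Complex.I) * h1 + (Complex.exp (x * Complex.I) -
      Complex.exp (-x * Complex.I)) * Complex.I_sq
  rw [e] at h
  have hx' : (x : ℂ) ≠ 0 := by exact_mod_cast hx
  field_simp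
  linear_combination h

/-- Concavity gives `cos t ≥ 1 - 2|t|/π`. The sum of two exponentials dominates the integrand on
both halves of the interval and integrates to `π/K * (1 - e^(-2K))`. -/
lemma integral_exp_neg_mul_cos_le {K : ℝ} (hK : 0 < K) :
    ∫ t : ℝ in -(Real.pi / 2)..Real.pi / 2, Real.exp (-(Real.cos t * K)) ≤ Real.pi / K := by
  have hp := Real.pi_pos
  have key : ∀ t ∈ Set.Icc (-(Real.pi / 2)) (Real.pi / 2), Real.exp (-(Real.cos t * K)) ≤
      Real.exp (-K) * (Real.exp (2 * K / Real.pi * t) + Real.exp (-(2 * K / Real.pi) * t)) := by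
    intro t ht
    rw [mul_add, ← Real.exp_add, ← Real.exp_add]
    rcases le_total 0 t with h | h
    · have := Real.one_sub_mul_le_cos h ht.2
      have h2 : -(Real.cos t * K) ≤ -K + 2 * K / Real.pi * t := by
        have := mul_le_mul_of_nonneg_right this hK.le
        have e : 2 * K / Real.pi * t = (2 / Real.pi * t) * K := by ring
        rw [e]; linarith
      linarith [Real.exp_le_exp.2 h2, Real.exp_pos (-K + -(2 * K / Real.pi) * t)]
    · have := Real.one_add_mul_le_cos ht.1 h
      have h2 : -(Real.cos t * K) ≤ -K + -(2 * K / Real.pi) * t := by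
        have := mul_le_mul_of_nonneg_right this hK.le
        have e : -(2 * K / Real.pi) * t = -(2 / Real.pi * t) * K := by ring
        rw [e]; linarith
      linarith [Real.exp_le_exp.2 h2, Real.exp_pos (-K + 2 * K / Real.pi * t)]
  have hc : 2 * K / Real.pi ≠ 0 := by positivity
  refine (intervalIntegral.integral_mono_on (by linarith)
    (Continuous.intervalIntegrable (by fun_prop) _ _)
    (Continuous.intervalIntegrable (by fun_prop) _ _) key).trans ?_
  rw [intervalIntegral.integral_const_mul, intervalIntegral.integral_add
    (Continuous.intervalIntegrable (by fun_prop) _ _)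
    (Continuous.intervalIntegrable (by fun_prop) _ _),
    intervalIntegral.integral_comp_mul_left (fun t => Real.exp t) hc,
    intervalIntegral.integral_comp_mul_left (fun t => Real.exp t) (neg_ne_zero.2 hc),
    integral_exp, integral_exp]
  have e1 : 2 * K / Real.pi * (Real.pi / 2) = K := by field_simp
  have e2 : 2 * K / Real.pi * -(Real.pi / 2) = -K := by field_simp
  have e3 : -(2 * K / Real.pi) * (Real.pi / 2) = -K := by field_simp
  have e4 : -(2 * K / Real.pi) * -(Real.pi / 2) = K := by field_simp
  rw [e1, e2, e3, e4]
  simp only [smul_eq_mul]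
  have e5 : Real.exp (-K) * ((2 * K / Real.pi)⁻¹ * (Real.exp K - Real.exp (-K)) +
      (-(2 * K / Real.pi))⁻¹ * (Real.exp (-K) - Real.exp K)) =
      Real.pi / K * (Real.exp (-K) * Real.exp K - Real.exp (-K) * Real.exp (-K)) := by
    field_simp
    ring
  rw [e5, ← Real.exp_add, neg_add_cancel, Real.exp_zero]
  have : 0 ≤ Real.pi / K := by positivity
  nlinarith [mul_pos (Real.exp_pos (-K)) (Real.exp_pos (-K))]

lemma norm_sin_add_mul_I_le (t y : ℝ) :
    ‖Complex.sin (t + y * Complex.I)‖ ≤ Real.cosh y := by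
  refine abs_le_of_sq_le_sq' ?_ (Real.cosh_pos y).le |>.2
  rw [← Complex.normSq_eq_norm_sq, Complex.sin_add_mul_I, ← Complex.ofReal_cos,
    ← Complex.ofReal_sin, ← Complex.ofReal_cosh, ← Complex.ofReal_sinh, ← Complex.ofReal_mul,
    ← Complex.ofReal_mul, Complex.normSq_add_mul_I]
  nlinarith [Real.sin_sq_add_cos_sq t, Real.cosh_sq y, sq_nonneg (Real.cos t)]

lemma integral_cosh (h : ℝ) : ∫ y : ℝ in 0..h, Real.cosh y = Real.sinh h := by
  rw [intervalIntegral.integral_eq_sub_of_hasDerivAt (fun y _ => Real.hasDerivAt_sinh y)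
    (Real.continuous_cosh.intervalIntegrable _ _)]
  simp

lemma integral_sinh (h : ℝ) : ∫ y : ℝ in 0..h, Real.sinh y = Real.cosh h - 1 := by
  rw [intervalIntegral.integral_eq_sub_of_hasDerivAt (fun y _ => Real.hasDerivAt_cosh y)
    (Real.continuous_sinh.intervalIntegrable _ _)]
  simp

/-- After the shift by `h` the top segment decays like `exp (-K cos t)`, and each vertical side
costs at most `∫ cosh = sinh h`. -/
lemma norm_esArcSin_le {b x h K : ℝ} (hh : 0 ≤ h) (hK : 0 < K)
    (hKle : K ≤ x * Real.sinh h - b * Real.cosh h) :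
    ‖esArcSin b x‖ ≤ Real.cosh h * (Real.pi / K) + 2 * Real.sinh h := by
  have hp := Real.pi_pos
  unfold esArcSin
  rw [integral_arc_shift (F := fun z => Complex.sin z * arcExp b x z)
    (Complex.differentiable_sin.mul (differentiable_arcExp b x)) h]
  have h1 : ‖∫ t : ℝ in -(Real.pi / 2)..Real.pi / 2, Complex.sin (t + h * Complex.I) *
      arcExp b x (t + h * Complex.I)‖ ≤ Real.cosh h * (Real.pi / K) := by
    refine (intervalIntegral.norm_integral_le_of_norm_le (by linarith)
      (g := fun t => Real.cosh h * Real.exp (-(Real.cos t * K)))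
      (Eventually.of_forall fun t ht => ?_)
      (Continuous.intervalIntegrable (by fun_prop) _ _)).trans ?_
    · rw [norm_mul, norm_arcExp_add_mul_I]
      have hc : 0 ≤ Real.cos t := Real.cos_nonneg_of_mem_Icc ⟨ht.1.le, ht.2⟩
      gcongr
      exact norm_sin_add_mul_I_le t h
    · rw [intervalIntegral.integral_const_mul]
      exact mul_le_mul_of_nonneg_left (integral_exp_neg_mul_cos_le hK) (Real.cosh_pos h).le
  have hv : ∀ s : ℝ, (∀ y : ℝ, ‖Complex.sin ((s : ℝ) + y * Complex.I)‖ = Real.cosh y) →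
      (∀ y : ℝ, ‖arcExp b x ((s : ℝ) + y * Complex.I)‖ = 1) →
      ‖Complex.I * ∫ y : ℝ in 0..h, Complex.sin ((s : ℝ) + y * Complex.I) *
        arcExp b x ((s : ℝ) + y * Complex.I)‖ ≤ Real.sinh h := by
    intro s e1 e2
    rw [norm_mul, Complex.norm_I, one_mul, ← integral_cosh]
    refine intervalIntegral.norm_integral_le_of_norm_le hh
      (Eventually.of_forall fun y _ => ?_) (Real.continuous_cosh.intervalIntegrable _ _)
    rw [norm_mul, e1, e2, mul_one]
  have h2 := hv (Real.pi / 2) (fun y => by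
    rw [sin_pi_div_two_add_mul_I, Complex.norm_real, Real.norm_of_nonneg (Real.cosh_pos y).le])
    (norm_arcExp_pi_div_two b x)
  have h3 := hv (-(Real.pi / 2)) (fun y => by
    rw [sin_neg_pi_div_two_add_mul_I, norm_neg, Complex.norm_real,
      Real.norm_of_nonneg (Real.cosh_pos y).le]) (norm_arcExp_neg_pi_div_two b x)
  refine (norm_add_le _ _).trans ?_
  linarith [norm_sub_le (∫ t : ℝ in -(Real.pi / 2)..Real.pi / 2, Complex.sin (t + h * Complex.I) *
      arcExp b x (t + h * Complex.I)) (Complex.I * ∫ y : ℝ in 0..h,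
      Complex.sin ((Real.pi / 2 : ℝ) + y * Complex.I) *
        arcExp b x ((Real.pi / 2 : ℝ) + y * Complex.I))]

/-! ### Lower bound up to the cutoff. -/

/-- The constant 2 is what absorbs the two vertical sides in `arcMass_le_re_esArc_of_cosh_sinh`. -/
lemma two_le_arcMass {d : ℝ} (hd : 0 ≤ d) : 2 ≤ arcMass d := by
  have h2 : ∫ t : ℝ in -(Real.pi / 2)..Real.pi / 2, Real.cos t = 2 := by
    rw [integral_cos, Real.sin_neg, Real.sin_pi_div_two]; norm_num
  rw [← h2]
  refine intervalIntegral.integral_mono_on (by linarith [Real.pi_pos])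
    (Real.continuous_cos.intervalIntegrable _ _)
    (Continuous.intervalIntegrable (by fun_prop) _ _) fun t ht => ?_
  have hc := Real.cos_nonneg_of_mem_Icc ht
  nlinarith [Real.one_le_exp (mul_nonneg hd hc)]

lemma arcMass_mono {d e : ℝ} (h : d ≤ e) : arcMass d ≤ arcMass e := by
  refine intervalIntegral.integral_mono_on (by linarith [Real.pi_pos])
    (Continuous.intervalIntegrable (by fun_prop) _ _)
    (Continuous.intervalIntegrable (by fun_prop) _ _) fun t ht => ?_
  have hc := Real.cos_nonneg_of_mem_Icc ht
  gcongr

/-- Laplace's method in crude form: keep only `|t| ≤ s`, where `d cos t ≥ d - d t²/2 ≥ d - K/2`. -/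
lemma le_arcMass {d s K : ℝ} (hd : 0 ≤ d) (hs0 : 0 ≤ s) (hs1 : s ≤ 1) (hK : d * s ^ 2 ≤ K) :
    2 * Real.cos 1 * Real.exp (-(K / 2)) * (s * Real.exp d) ≤ arcMass d := by
  have hp := Real.pi_gt_three
  have h1 : ∫ t : ℝ in (-s)..s, Real.cos 1 * Real.exp (d - K / 2) ≤ arcMass d := by
    refine (intervalIntegral.integral_mono_on (by linarith)
      (g := fun t => Real.cos t * Real.exp (d * Real.cos t))
      (Continuous.intervalIntegrable (by fun_prop) _ _)
      (Continuous.intervalIntegrable (by fun_prop) _ _) fun t ht => ?_).trans ?_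
    · have ha : |t| ≤ s := abs_le.2 ht
      have hc : Real.cos 1 ≤ Real.cos t := by
        rw [← Real.cos_abs t]
        exact Real.cos_le_cos_of_nonneg_of_le_pi (abs_nonneg t) (by linarith) (by linarith)
      have ht2 : t ^ 2 ≤ s ^ 2 := sq_le_sq' ht.1 ht.2
      have h3 : d - K / 2 ≤ d * Real.cos t := by
        nlinarith [Real.one_sub_sq_div_two_le_cos (x := t)]
      have := Real.cos_one_pos
      gcongr
      exact this.le.trans hc
    · refine intervalIntegral.integral_mono_interval (by linarith) (by linarith) (by linarith)
        ?_ (Continuous.intervalIntegrable (by fun_prop) _ _)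
      refine (MeasureTheory.ae_restrict_mem measurableSet_Ioc).mono fun t ht => ?_
      have hc := Real.cos_nonneg_of_mem_Icc ⟨ht.1.le, ht.2⟩
      simp only [Pi.zero_apply]
      positivity
  rw [intervalIntegral.integral_const, smul_eq_mul, sub_eq_add_neg, sub_eq_add_neg,
    Real.exp_add] at h1
  linarith

/-- Below the cutoff, with `b = d cosh τ` and `x = d sinh τ`. -/
lemma arcMass_le_re_esArc_of_cosh_sinh {d τ : ℝ} (hd : 0 ≤ d) (hτ : 0 ≤ τ) :
    arcMass d ≤ (esArc (d * Real.cosh τ) (d * Real.sinh τ)).re := by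
  have hp := Real.pi_pos
  set b := d * Real.cosh τ with hb
  set x := d * Real.sinh τ with hx
  unfold esArc
  rw [integral_arc_shift (F := fun z => Complex.cos z * arcExp b x z)
    (Complex.differentiable_cos.mul (differentiable_arcExp b x)) τ]
  have hv : ∀ s : ℝ, (∀ y : ℝ, ‖Complex.cos ((s : ℝ) + y * Complex.I)‖ = |Real.sinh y|) →
      (∀ y : ℝ, ‖arcExp b x ((s : ℝ) + y * Complex.I)‖ = 1) →
      ‖Complex.I * ∫ y : ℝ in 0..τ, Complex.cos ((s : ℝ) + y * Complex.I) *
        arcExp b x ((s : ℝ) + y * Complex.I)‖ ≤ Real.cosh τ - 1 := by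
    intro s e1 e2
    rw [norm_mul, Complex.norm_I, one_mul, ← integral_sinh]
    refine intervalIntegral.norm_integral_le_of_norm_le hτ
      (Eventually.of_forall fun y hy => ?_) (Real.continuous_sinh.intervalIntegrable _ _)
    rw [norm_mul, e1, e2, mul_one, abs_of_nonneg (Real.sinh_nonneg_iff.2 hy.1.le)]
  have h2 := hv (Real.pi / 2) (fun y => by
    rw [cos_pi_div_two_add_mul_I, norm_neg, norm_mul, Complex.norm_I, mul_one, Complex.norm_real,
      Real.norm_eq_abs]) (norm_arcExp_pi_div_two b x)
  have h3 := hv (-(Real.pi / 2)) (fun y => by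
    rw [cos_neg_pi_div_two_add_mul_I, norm_mul, Complex.norm_I, mul_one, Complex.norm_real,
      Real.norm_eq_abs]) (norm_arcExp_neg_pi_div_two b x)
  have h1 : (∫ t : ℝ in -(Real.pi / 2)..Real.pi / 2, Complex.cos (t + τ * Complex.I) *
      arcExp b x (t + τ * Complex.I)).re = Real.cosh τ * arcMass d := by
    have hi : Continuous fun t : ℝ => Complex.cos (t + τ * Complex.I) *
        arcExp b x (t + τ * Complex.I) := by
      have := (differentiable_arcExp b x).continuous
      fun_prop
    have := Complex.reCLM.intervalIntegral_comp_comm (hi.intervalIntegrable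
      (-(Real.pi / 2)) (Real.pi / 2) (μ := MeasureTheory.volume))
    simp only [Complex.reCLM_apply] at this
    rw [← this, arcMass, ← intervalIntegral.integral_const_mul]
    refine intervalIntegral.integral_congr fun t _ => ?_
    -- By `cosh² - sinh² = 1` the phase cancels and the exponent is real.
    have e : arcExp b x (t + τ * Complex.I) = (Real.exp (d * Real.cos t) : ℝ) := by
      rw [arcExp, Complex.ofReal_exp]
      congr 1
      rw [Complex.cos_add_mul_I, Complex.sin_add_mul_I, hb, hx]
      push_cast
      have := Complex.cosh_sq (τ : ℂ)
      linear_combination (d * Complex.cos t) * this + d * (Complex.sinh τ * Complex.cos t *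
        Complex.sinh τ) * Complex.I_sq
    simp only [e, Complex.cos_add_mul_I]
    simp [← Complex.ofReal_cos, ← Complex.ofReal_sin, ← Complex.ofReal_cosh,
      ← Complex.ofReal_sinh, -Complex.ofReal_exp]
    ring
  rw [Complex.add_re, Complex.sub_re, h1]
  have h2' := (Complex.re_le_norm _).trans h2
  have h3' := (abs_le.1 ((Complex.abs_re_le_norm _).trans h3)).1
  have hm := two_le_arcMass hd
  have hc := Real.one_le_cosh τ
  -- The sides cost at most `2 (cosh τ - 1)`, and `(cosh τ - 1) (arcMass d - 2) ≥ 0`.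
  nlinarith

lemma continuous_esArc (b : ℝ) : Continuous (esArc b) := by
  unfold esArc
  refine intervalIntegral.continuous_parametric_intervalIntegral_of_continuous' ?_ _ _
  unfold arcExp Function.uncurry
  fun_prop

/-- Up to and including the cutoff `x = b`. -/
lemma arcMass_le_re_esArc {b x d : ℝ} (hb : 0 < b) (hx : |x| ≤ b) (hd0 : 0 ≤ d)
    (hd : d ^ 2 ≤ b ^ 2 - x ^ 2) : arcMass d ≤ (esArc b x).re := by
  have hlt : ∀ y : ℝ, 0 ≤ y → y < b → d ^ 2 ≤ b ^ 2 - y ^ 2 → arcMass d ≤ (esArc b y).re := by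
    intro y hy hyb hdy
    have hq : y / b ∈ Set.Ioo (-1 : ℝ) 1 :=
      ⟨by linarith [div_nonneg hy hb.le], (div_lt_one hb).2 hyb⟩
    have hr : 0 < 1 - (y / b) ^ 2 := by
      have := hq.1; have := hq.2; nlinarith
    have hs := Real.sqrt_pos.2 hr
    have h := arcMass_le_re_esArc_of_cosh_sinh (d := b * Real.sqrt (1 - (y / b) ^ 2))
      (τ := Real.artanh (y / b)) (by positivity)
      (Real.sinh_nonneg_iff.1 (by rw [Real.sinh_artanh hq]; positivity))
    rw [Real.sinh_artanh hq, Real.cosh_artanh hq] at h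
    have e1 : b * Real.sqrt (1 - (y / b) ^ 2) * (1 / Real.sqrt (1 - (y / b) ^ 2)) = b := by
      rw [mul_assoc, mul_one_div_cancel hs.ne', mul_one]
    have e2 : b * Real.sqrt (1 - (y / b) ^ 2) * (y / b / Real.sqrt (1 - (y / b) ^ 2)) = y := by
      rw [mul_assoc, mul_div_cancel₀ _ hs.ne', mul_div_cancel₀ _ hb.ne']
    rw [e1, e2] at h
    refine (arcMass_mono ?_).trans h
    refine abs_le_of_sq_le_sq' ?_ (by positivity) |>.2
    rw [mul_pow, Real.sq_sqrt hr.le]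
    refine hdy.trans_eq ?_
    field_simp
  rw [← esArc_abs]
  rw [← sq_abs x] at hd
  have hy := abs_nonneg x
  generalize |x| = y at hx hd hy
  rcases hx.lt_or_eq with h | rfl
  · exact hlt y hy h hd
  -- At the cutoff itself `τ` would be infinite; the bound passes to the limit from the left by
  -- continuity of `esArc`.
  · obtain rfl : d = 0 := by nlinarith
    refine ge_of_tendsto (x := 𝓝[<] y) ((Complex.continuous_re.comp
      (continuous_esArc y)).continuousAt.mono_left nhdsWithin_le_nhds) ?_
    filter_upwards [Ioo_mem_nhdsLT hb] with z hz
    exact hlt z hz.1.le hz.2 (by nlinarith [hz.1, hz.2])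

/-! ### Sawtooth series. -/

lemma norm_sum_range_pow_le {z : ℂ} (hz : ‖z‖ = 1) (hz1 : z ≠ 1) (n : ℕ) :
    ‖∑ i ∈ Finset.range n, z ^ i‖ ≤ 2 / ‖z - 1‖ := by
  rw [geom_sum_eq hz1, norm_div]
  gcongr
  refine (norm_sub_le _ _).trans ?_
  rw [norm_pow, hz, one_pow, norm_one]
  norm_num

/-- Dirichlet's test for `∑ z ^ n / n` on the unit circle. -/
lemma exists_tendsto_sum_pow_div {z : ℂ} (hz : ‖z‖ = 1) (hz1 : z ≠ 1) :
    ∃ l : ℂ, Tendsto (fun n : ℕ => ∑ i ∈ Finset.range n, z ^ i / (i : ℂ)) atTop (𝓝 l) := by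
  have ha : Antitone fun n : ℕ => 1 / ((n : ℝ) + 1) := fun m n h => by
    have : (m : ℝ) ≤ n := by exact_mod_cast h
    dsimp only
    gcongr
  have hc := ha.cauchySeq_series_mul_of_tendsto_zero_of_bounded
    tendsto_one_div_add_atTop_nhds_zero_nat (z := fun i => z ^ (i + 1)) (b := 2 / ‖z - 1‖)
    (fun n => by
      simp_rw [pow_succ]
      rw [← Finset.sum_mul, norm_mul, hz, mul_one]
      exact norm_sum_range_pow_le hz hz1 n)
  obtain ⟨l, hl⟩ := cauchySeq_tendsto_of_complete hc
  refine ⟨l, (tendsto_add_atTop_iff_nat 1).1 (hl.congr fun n => ?_)⟩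
  rw [Finset.sum_range_succ']
  simp [div_eq_mul_inv, mul_comm]

/-- By Abel's limit theorem `l` is the radial limit of `-log (1 - z r)`, whose imaginary part is an
argument. The bound is thus uniform in `z`, although the real part is unbounded near `z = 1`. -/
lemma abs_im_le_pi_of_tendsto_sum_pow_div {z l : ℂ} (hz : ‖z‖ = 1)
    (hl : Tendsto (fun n : ℕ => ∑ i ∈ Finset.range n, z ^ i / (i : ℂ)) atTop (𝓝 l)) :
    |l.im| ≤ Real.pi := by
  have h := Complex.tendsto_tsum_powerSeries_nhdsWithin_lt hl
  rw [tendsto_map'_iff] at h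
  refine le_of_tendsto (x := 𝓝[<] (1 : ℝ))
    ((continuous_abs.comp Complex.continuous_im).continuousAt.tendsto.comp h) ?_
  filter_upwards [Ioo_mem_nhdsLT (zero_lt_one : (0 : ℝ) < 1)] with r hr
  have hn : ‖z * r‖ < 1 := by
    rw [norm_mul, hz, one_mul, Complex.norm_real, Real.norm_of_nonneg hr.1.le]
    exact hr.2
  have e : ∑' n : ℕ, z ^ n / (n : ℂ) * (r : ℂ) ^ n = -Complex.log (1 - z * r) := by
    rw [← (Complex.hasSum_taylorSeries_neg_log hn).tsum_eq]
    refine tsum_congr fun n => ?_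
    rw [mul_pow]
    ring
  simp only [Function.comp_apply, e, Complex.neg_im, abs_neg, Complex.log_im]
  exact Complex.abs_arg_le_pi _

lemma sum_Icc_neg_eq_sum_range (f : ℤ → ℂ) (hf : f 0 = 0) (n : ℕ) :
    ∑ m ∈ Finset.Icc (-(n : ℤ)) n, f m = ∑ i ∈ Finset.range (n + 1), (f i + f (-i)) := by
  induction n with
  | zero => simp [hf]
  | succ n ih =>
    rw [Finset.sum_range_succ, ← ih]
    have e : Finset.Icc (-((n + 1 : ℕ) : ℤ)) ((n + 1 : ℕ) : ℤ) =
        insert (-((n + 1 : ℕ) : ℤ)) (insert ((n + 1 : ℕ) : ℤ) (Finset.Icc (-(n : ℤ)) n)) := by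
      ext m
      simp only [Finset.mem_Icc, Finset.mem_insert]
      omega
    rw [e, Finset.sum_insert, Finset.sum_insert]
    · ring
    · simp
    · simp only [Finset.mem_Icc, Finset.mem_insert]
      omega

/-- The sawtooth series: it converges everywhere, and its sums are bounded. -/
lemma exists_hasSum_exp_div_int (θ : ℝ) :
    ∃ l : ℂ, HasSum (fun m : ℤ => Complex.exp (Complex.I * m * θ) / (m : ℂ)) l
      (SummationFilter.symmetricIcc ℤ) ∧ ‖l‖ ≤ 2 * Real.pi := by
  set z : ℂ := Complex.exp (Complex.I * θ) with hzdef
  have hz : ‖z‖ = 1 := by rw [hzdef, mul_comm, Complex.norm_exp_ofReal_mul_I]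
  -- The terms at `m` and `-m` combine to `z^m / m` minus its conjugate. Hence the symmetric sums
  -- converge even at `z = 1`, where they vanish.
  have key : ∀ n : ℕ, ∑ m ∈ Finset.Icc (-(n : ℤ)) n,
      Complex.exp (Complex.I * m * θ) / (m : ℂ) =
      2 * Complex.I * ((∑ i ∈ Finset.range (n + 1), z ^ i / (i : ℂ)).im : ℂ) := by
    intro n
    rw [sum_Icc_neg_eq_sum_range _ (by simp), Complex.im_sum, Complex.ofReal_sum, Finset.mul_sum]
    refine Finset.sum_congr rfl fun i _ => ?_
    have e1 : z ^ i = Complex.exp (Complex.I * i * θ) := by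
      rw [hzdef, ← Complex.exp_nat_mul]; congr 1; ring
    have e2 : (starRingEnd ℂ) (z ^ i) = Complex.exp (Complex.I * ((-i : ℤ) : ℂ) * θ) := by
      rw [e1, ← Complex.exp_conj]; congr 1; simp
    have h3 := Complex.sub_conj (z ^ i / (i : ℂ))
    rw [map_div₀, Complex.conj_natCast, e2] at h3
    rw [e1] at h3 ⊢
    push_cast at h3 ⊢
    linear_combination h3
  by_cases hz1 : z = 1
  · refine ⟨0, ?_, by simp [Real.pi_pos.le]⟩
    rw [SummationFilter.hasSum_symmetricIcc_iff]
    refine tendsto_const_nhds.congr fun n => ?_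
    rw [key, hz1]
    simp [Complex.im_sum]
  · obtain ⟨l, hl⟩ := exists_tendsto_sum_pow_div hz hz1
    refine ⟨2 * Complex.I * (l.im : ℂ), ?_, ?_⟩
    · rw [SummationFilter.hasSum_symmetricIcc_iff]
      simp_rw [key]
      have := hl.comp (tendsto_add_atTop_nat 1)
      exact ((Complex.continuous_ofReal.comp Complex.continuous_im).continuousAt.tendsto.comp
        this).const_mul _
    · have := abs_im_le_pi_of_tendsto_sum_pow_div hz hl
      simp
      linarith

lemma summable_one_div_int_sq : Summable fun m : ℤ => 1 / (m : ℝ) ^ 2 := by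
  exact_mod_cast Real.summable_one_div_int_pow.2 one_lt_two

lemma half_abs_le_abs_add {κ : ℝ} (hκ : |κ| ≤ 1 / 2) {m : ℤ} (hm : m ≠ 0) :
    |(m : ℝ)| / 2 ≤ |(m : ℝ) + κ| := by
  have h1 : (1 : ℝ) ≤ |(m : ℝ)| := by exact_mod_cast Int.one_le_abs hm
  have h2 := abs_sub_abs_le_abs_sub (m : ℝ) (-κ)
  rw [abs_neg, sub_neg_eq_add] at h2
  linarith

/-- The sawtooth series with shifted denominators. -/
lemma exists_hasSum_exp_div_int_add :
    ∃ C : ℝ, ∀ κ : ℝ, |κ| ≤ 1 / 2 → ∀ θ : ℝ, ∃ l : ℂ,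
      HasSum (fun m : ℤ => if m = 0 then 0 else
        Complex.exp (Complex.I * m * θ) / ((m : ℂ) + κ)) l
        (SummationFilter.symmetricIcc ℤ) ∧ ‖l‖ ≤ C := by
  refine ⟨2 * Real.pi + ∑' m : ℤ, 1 / (m : ℝ) ^ 2, fun κ hκ θ => ?_⟩
  obtain ⟨l, hl, hlb⟩ := exists_hasSum_exp_div_int θ
  set r : ℤ → ℂ := fun m => (if m = 0 then 0 else
        Complex.exp (Complex.I * m * θ) / ((m : ℂ) + κ)) -
        Complex.exp (Complex.I * m * θ) / (m : ℂ) with hr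
  have hrb : ∀ m, ‖r m‖ ≤ 1 / (m : ℝ) ^ 2 := by
    intro m
    by_cases hm : m = 0
    -- At `m = 0` both sides are zero, as division by zero gives zero.
    · simp [hr, hm]
    have hm' : (m : ℝ) ≠ 0 := by exact_mod_cast hm
    have h1 := half_abs_le_abs_add hκ hm
    have hmp : 0 < |(m : ℝ)| := abs_pos.2 hm'
    have hmκ : (m : ℝ) + κ ≠ 0 := abs_pos.1 (by linarith)
    have e : r m = Complex.exp ((m * θ : ℝ) * Complex.I) *
        ((-κ / (m * (m + κ)) : ℝ) : ℂ) := by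
      have c1 : (m : ℂ) ≠ 0 := by exact_mod_cast hm
      have c2 : (m : ℂ) + κ ≠ 0 := by exact_mod_cast hmκ
      have c3 : ((m * θ : ℝ) : ℂ) * Complex.I = Complex.I * m * θ := by push_cast; ring
      simp only [hr, if_neg hm]
      rw [c3]
      push_cast
      field_simp
      ring
    rw [e, norm_mul, Complex.norm_exp_ofReal_mul_I, one_mul, Complex.norm_real, Real.norm_eq_abs,
      abs_div, abs_neg, abs_mul, div_le_div_iff₀ (by positivity) (by positivity), one_mul,
      ← sq_abs (m : ℝ)]
    nlinarith [mul_le_mul_of_nonneg_left h1 hmp.le,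
      mul_le_mul_of_nonneg_right hκ (sq_nonneg |(m : ℝ)|)]
  have hrs : Summable r := Summable.of_norm_bounded summable_one_div_int_sq hrb
  have hrn : ‖∑' m, r m‖ ≤ ∑' m : ℤ, 1 / (m : ℝ) ^ 2 :=
    tsum_of_norm_bounded summable_one_div_int_sq.hasSum hrb
  refine ⟨l + ∑' m, r m, ?_, (norm_add_le _ _).trans (add_le_add hlb hrn)⟩
  convert hl.add (hrs.hasSum.mono_left (SummationFilter.symmetricIcc ℤ).le_atTop) using 2 with m
  simp [hr]

/-! ### The transform beyond the cutoff without its jump term. -/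

/-- The constant in the bound for the Fourier transform beyond the cutoff, with the jump term
removed. -/
def remainderConst (g b : ℝ) : ℝ :=
  g ^ 2 * (1 / Real.sqrt (1 - g ^ 2)) * (Real.pi * g / (b * (1 - g)) + 2 * g)

/-- Since `esBeta` grows with `w`, this lets the value at `w = 1` serve for all `w ≥ 1`. -/
lemma remainderConst_anti {g b c : ℝ} (hg0 : 0 < g) (hg1 : g < 1) (hb : 0 < b) (hbc : b ≤ c) :
    remainderConst g c ≤ remainderConst g b := by
  have := Real.pi_pos
  have : 0 < 1 - g := by linarith
  unfold remainderConst
  gcongr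

/-- The shift `tanh h = g / r` shrinks as `r` grows, so both `sinh h` and `1 / K` are `O(1/r)`; the
prefactor satisfies `b / x ≤ g² / r²`. Together they give `r^(-3)`. One factor `g` of the gap `g²`
keeps `x tanh h - b` positive. -/
lemma norm_esArc_sub_jump_le_of_pos {g b r x : ℝ} (hg0 : 0 < g) (hg1 : g < 1) (hb : 0 < b)
    (hr : 1 ≤ r) (hx : b * r ^ 2 ≤ g ^ 2 * x) :
    ‖esArc b x - 2 * Real.sin x / x‖ ≤ remainderConst g b * (1 / r ^ 3) := by
  have hp := Real.pi_pos
  have hr0 : 0 < r := by linarith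
  have hx0 : 0 < x := by
    have : 0 < g ^ 2 * x := lt_of_lt_of_le (by positivity) hx
    exact (pos_iff_pos_of_mul_pos this).1 (by positivity)
  have ht0 : 0 < g / r := by positivity
  have htg : g / r ≤ g := div_le_self hg0.le hr
  have ht : g / r ∈ Set.Ioo (-1 : ℝ) 1 := ⟨by linarith, by linarith⟩
  have hg2 : 0 < 1 - g ^ 2 := by nlinarith
  have hle : 1 - g ^ 2 ≤ 1 - (g / r) ^ 2 := by nlinarith
  have hs0 : 0 < Real.sqrt (1 - g ^ 2) := Real.sqrt_pos.2 hg2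
  have hsle := Real.sqrt_le_sqrt hle
  have hs1 : Real.sqrt (1 - (g / r) ^ 2) ≤ 1 := Real.sqrt_le_one.2 (by nlinarith)
  have hst : 0 < Real.sqrt (1 - (g / r) ^ 2) := hs0.trans_le hsle
  have h1g : 0 < 1 - g := by linarith
  have hxt : b * r * (1 - g) / g ≤ x * (g / r) - b := by
    have h1 : b * r / g ≤ x * (g / r) := by
      rw [← mul_div_assoc, div_le_div_iff₀ hg0 hr0]
      linarith
    have h2 : b * r * (1 - g) / g = b * r / g - b * r := by field_simp
    nlinarith
  have hK0 : 0 < b * r * (1 - g) / g := by positivity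
  have hG := norm_esArcSin_le (b := b) (x := x) (h := Real.artanh (g / r))
    (Real.sinh_nonneg_iff.1 (by rw [Real.sinh_artanh ht]; positivity)) hK0 (by
      rw [Real.sinh_artanh ht, Real.cosh_artanh ht]
      have e : x * (g / r / Real.sqrt (1 - (g / r) ^ 2)) -
          b * (1 / Real.sqrt (1 - (g / r) ^ 2)) =
          (x * (g / r) - b) / Real.sqrt (1 - (g / r) ^ 2) := by ring
      rw [e]
      exact hxt.trans (le_div_self (hK0.le.trans hxt) hst hs1))
  rw [Real.sinh_artanh ht, Real.cosh_artanh ht] at hG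
  have hG' : ‖esArcSin b x‖ ≤ 1 / Real.sqrt (1 - g ^ 2) * (Real.pi / (b * r * (1 - g) / g)) +
      2 * (g / r / Real.sqrt (1 - g ^ 2)) := hG.trans (by gcongr)
  rw [esArc_eq_jump_add b hx0.ne', add_sub_cancel_left, norm_mul, norm_div, norm_mul,
    Complex.norm_I, one_mul, Complex.norm_real, Complex.norm_real, Real.norm_of_nonneg hb.le,
    Real.norm_of_nonneg hx0.le]
  have hbx : b / x ≤ g ^ 2 / r ^ 2 := by
    rw [div_le_div_iff₀ hx0 (by positivity)]
    linarith
  refine (mul_le_mul hbx hG' (norm_nonneg _) (by positivity)).trans_eq ?_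
  unfold remainderConst
  field_simp

lemma norm_esArc_sub_jump_le {g b r x : ℝ} (hg0 : 0 < g) (hg1 : g < 1) (hb : 0 < b)
    (hr : 1 ≤ r) (hx : b * r ^ 2 ≤ g ^ 2 * |x|) :
    ‖esArc b x - 2 * Real.sin x / x‖ ≤ remainderConst g b * (1 / r ^ 3) := by
  have h := norm_esArc_sub_jump_le_of_pos hg0 hg1 hb hr hx
  rw [esArc_abs] at h
  have e : (2 * Real.sin |x| / (|x| : ℝ) : ℂ) = 2 * Real.sin x / x := by
    rcases abs_choice x with e | e <;> rw [e]
    rw [Real.sin_neg, Complex.ofReal_neg, Complex.ofReal_neg, mul_neg, neg_div_neg_eq]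
  rwa [e] at h

/-! ### The alias series. -/

section

variable {N : ℕ} {σ γ : ℝ}

lemma esBeta_pos (hσ : 1 < σ) (hγ : 0 < γ) {w : ℝ} (hw : 0 < w) : 0 < esBeta σ γ w := by
  have := Real.pi_pos
  have h : 1 / (2 * σ) < 1 := by rw [div_lt_one (by linarith)]; linarith
  have h' : 0 < 1 - 1 / (2 * σ) := by linarith
  unfold esBeta
  positivity

lemma abs_div_le_of_mem_centralModes (hN : 0 < N) (hσ : 1 < σ) {k : ℤ} (hk : k ∈ centralModes N) :
    |(k : ℝ) / (σ * N)| ≤ 1 / (2 * σ) := by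
  have hN' : (0 : ℝ) < N := by exact_mod_cast hN
  have hk' : |(k : ℝ)| ≤ N / 2 := hk
  rw [abs_div, abs_of_pos (show 0 < σ * N by positivity), div_le_div_iff₀ (by positivity)
    (by positivity)]
  nlinarith

/-- Aliased frequencies lie beyond the cutoff. -/
lemma esBeta_mul_abs_le (hσ : 1 < σ) (hγ : 0 < γ) {w κ : ℝ} (hw : 0 < w)
    (hκ : |κ| ≤ 1 / (2 * σ)) {m : ℤ} (hm : m ≠ 0) :
    esBeta σ γ w * |(m : ℝ)| ≤ γ * |Real.pi * w * (m + κ)| := by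
  have hp := Real.pi_pos
  have h1 : (1 : ℝ) ≤ |(m : ℝ)| := by exact_mod_cast Int.one_le_abs hm
  have h2 := abs_sub_abs_le_abs_sub (m : ℝ) (-κ)
  rw [abs_neg, sub_neg_eq_add] at h2
  have h0 : 0 ≤ 1 / (2 * σ) := by positivity
  have h3 : (1 - 1 / (2 * σ)) * |(m : ℝ)| ≤ |(m : ℝ) + κ| := by nlinarith
  rw [abs_mul, abs_of_pos (show 0 < Real.pi * w by positivity), esBeta]
  calc _ = γ * (Real.pi * w * ((1 - 1 / (2 * σ)) * |(m : ℝ)|)) := by ring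
    _ ≤ _ := by gcongr

/-- The jump part of the series. -/
lemma exists_hasSum_jump :
    ∃ C : ℝ, ∀ w κ y : ℝ, 0 < w → |κ| ≤ 1 / 2 → ∃ l : ℂ,
      HasSum (fun m : ℤ => if m = 0 then 0 else
        2 * Real.sin (Real.pi * w * (m + κ)) / (Real.pi * w * (m + κ) : ℝ) *
          Complex.exp (Complex.I * ((m + κ : ℝ) : ℂ) * y)) l
        (SummationFilter.symmetricIcc ℤ) ∧ ‖l‖ ≤ C / w := by
  obtain ⟨C, hC⟩ := exists_hasSum_exp_div_int_add
  refine ⟨2 * C / Real.pi, fun w κ y hw hκ => ?_⟩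
  have hp := Real.pi_pos
  -- Writing the sine as two exponentials moves the phase to `y ± π w`, leaving two sawtooth series
  -- with shifted denominators.
  obtain ⟨l₁, h₁, b₁⟩ := hC κ hκ (y + Real.pi * w)
  obtain ⟨l₂, h₂, b₂⟩ := hC κ hκ (y - Real.pi * w)
  have hs := ((h₁.mul_left (Complex.exp ((κ * (y + Real.pi * w) : ℝ) * Complex.I))).sub
    (h₂.mul_left (Complex.exp ((κ * (y - Real.pi * w) : ℝ) * Complex.I)))).mul_left
    (1 / (Complex.I * (Real.pi * w : ℝ)))
  refine ⟨1 / (Complex.I * (Real.pi * w : ℝ)) *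
    (Complex.exp ((κ * (y + Real.pi * w) : ℝ) * Complex.I) * l₁ -
      Complex.exp ((κ * (y - Real.pi * w) : ℝ) * Complex.I) * l₂), ?_, ?_⟩
  · refine (congrArg (fun f => HasSum f _ _) (funext fun m => ?_)).mpr hs
    by_cases hm : m = 0
    · simp [hm]
    have hmκ : (m : ℂ) + κ ≠ 0 := by
      have h1 := half_abs_le_abs_add hκ hm
      have hmp : 0 < |(m : ℝ)| := abs_pos.2 (by exact_mod_cast hm)
      exact_mod_cast abs_pos.1 (show 0 < |(m : ℝ) + κ| by linarith)
    have hpw : (Real.pi : ℂ) * w ≠ 0 := by exact_mod_cast (mul_pos hp hw).ne'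
    simp only [if_neg hm]
    have h2 := Complex.two_sin ((Real.pi * w * (m + κ) : ℝ) : ℂ)
    have e1 : Complex.exp ((κ * (y + Real.pi * w) : ℝ) * Complex.I) *
        Complex.exp (Complex.I * m * (y + Real.pi * w : ℝ)) =
        Complex.exp (((Real.pi * w * (m + κ) : ℝ) : ℂ) * Complex.I) *
        Complex.exp (Complex.I * ((m + κ : ℝ) : ℂ) * y) := by
      rw [← Complex.exp_add, ← Complex.exp_add]
      congr 1
      push_cast
      ring
    have e2 : Complex.exp ((κ * (y - Real.pi * w) : ℝ) * Complex.I) *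
        Complex.exp (Complex.I * m * (y - Real.pi * w : ℝ)) =
        Complex.exp (-((Real.pi * w * (m + κ) : ℝ) : ℂ) * Complex.I) *
        Complex.exp (Complex.I * ((m + κ : ℝ) : ℂ) * y) := by
      rw [← Complex.exp_add, ← Complex.exp_add]
      congr 1
      push_cast
      ring
    rw [← mul_div_assoc, ← mul_div_assoc, e1, e2, ← sub_div, ← sub_mul]
    have e3 : Complex.exp (((Real.pi * w * (m + κ) : ℝ) : ℂ) * Complex.I) -
        Complex.exp (-((Real.pi * w * (m + κ) : ℝ) : ℂ) * Complex.I) =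
        2 * Complex.I * Real.sin (Real.pi * w * (m + κ)) := by
      rw [Complex.ofReal_sin]
      linear_combination (-Complex.I) * h2 + (Complex.exp (((Real.pi * w * (m + κ) : ℝ) : ℂ) *
        Complex.I) - Complex.exp (-((Real.pi * w * (m + κ) : ℝ) : ℂ) * Complex.I)) *
        Complex.I_sq
    rw [e3]
    have e4 : ((Real.pi * w * (m + κ) : ℝ) : ℂ) = Real.pi * w * (m + κ) := by push_cast; ring
    have e5 : ((Real.pi * w : ℝ) : ℂ) = Real.pi * w := by push_cast; ring
    rw [e4, e5]
    field_simp
  · rw [norm_mul, norm_div, norm_one, norm_mul, Complex.norm_I, one_mul, Complex.norm_real,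
      Real.norm_of_nonneg (mul_pos hp hw).le]
    have h := norm_sub_le (Complex.exp ((κ * (y + Real.pi * w) : ℝ) * Complex.I) * l₁)
      (Complex.exp ((κ * (y - Real.pi * w) : ℝ) * Complex.I) * l₂)
    rw [norm_mul, norm_mul, Complex.norm_exp_ofReal_mul_I, Complex.norm_exp_ofReal_mul_I, one_mul,
      one_mul] at h
    calc _ ≤ 1 / (Real.pi * w) * (C + C) := by gcongr; linarith
      _ = _ := by field_simp; ring

/-- The factor common to all values of the Fourier transform of the kernel. -/
def kernelScale (N : ℕ) (σ γ w : ℝ) : ℝ :=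
  Real.pi * w / (σ * N) * Real.exp (-esBeta σ γ w)

lemma kernelScale_pos (hN : 0 < N) (hσ : 1 < σ) {w : ℝ} (hw : 0 < w) :
    0 < kernelScale N σ γ w := by
  have := Real.pi_pos
  unfold kernelScale
  positivity

lemma fourierHat_nufftKernel (hN : 0 < N) (hσ : 1 < σ) {w : ℝ} (hw : 0 < w) (q : ℝ) :
    fourierHat (nufftKernel N σ γ w) q =
      kernelScale N σ γ w * esArc (esBeta σ γ w) (Real.pi * w / (σ * N) * q) :=
  fourierHat_scaledKernel hw (by positivity) q

/-- Convergence of the alias series, with an explicit bound for its sums. -/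
lemma exists_hasSum_aliasTerm (hN : 0 < N) (hσ : 1 < σ) (hγ0 : 0 < γ) (hγ1 : γ < 1) :
    ∃ C T : ℝ, ∀ w : ℝ, 0 < w → ∀ k ∈ centralModes N, ∀ x : ℝ, ∃ l : ℂ,
      HasSum (aliasTerm N σ γ w k x) l (SummationFilter.symmetricIcc ℤ) ∧
      ‖l‖ ≤ kernelScale N σ γ w *
        (C / w + remainderConst (Real.sqrt γ) (esBeta σ γ w) * T) := by
  obtain ⟨C, hC⟩ := exists_hasSum_jump
  have hT : Summable fun m : ℤ => |(m : ℝ)| ^ (-(3 / 2 : ℝ)) :=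
    Real.summable_abs_int_rpow (by norm_num)
  refine ⟨C, ∑' m : ℤ, |(m : ℝ)| ^ (-(3 / 2 : ℝ)), fun w hw k hk x => ?_⟩
  have hp := Real.pi_pos
  have hN' : (0 : ℝ) < N := by exact_mod_cast hN
  set κ : ℝ := (k : ℝ) / (σ * N) with hκdef
  have hκ := abs_div_le_of_mem_centralModes hN hσ hk
  rw [← hκdef] at hκ
  have hκ2 : |κ| ≤ 1 / 2 := hκ.trans (by gcongr; linarith)
  have hb := esBeta_pos hσ hγ0 hw
  have hg0 : 0 < Real.sqrt γ := Real.sqrt_pos.2 hγ0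
  have hg1 : Real.sqrt γ < 1 := by rw [Real.sqrt_lt' one_pos]; linarith
  have hrc : 0 ≤ remainderConst (Real.sqrt γ) (esBeta σ γ w) := by
    have : 0 < 1 - Real.sqrt γ := by linarith
    unfold remainderConst
    positivity
  obtain ⟨l, hl, hlb⟩ := hC w κ (σ * N * x) hw hκ2
  set R : ℤ → ℂ := fun m => if m = 0 then 0 else
    (esArc (esBeta σ γ w) (Real.pi * w * (m + κ)) -
      2 * Real.sin (Real.pi * w * (m + κ)) / (Real.pi * w * (m + κ) : ℝ)) *
      Complex.exp (Complex.I * ((m + κ : ℝ) : ℂ) * (σ * N * x : ℝ)) with hR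
  have hRb : ∀ m, ‖R m‖ ≤ remainderConst (Real.sqrt γ) (esBeta σ γ w) *
      |(m : ℝ)| ^ (-(3 / 2 : ℝ)) := by
    intro m
    by_cases hm : m = 0
    · simp only [hR, hm, if_true, norm_zero]
      positivity
    have h1 : (1 : ℝ) ≤ |(m : ℝ)| := by exact_mod_cast Int.one_le_abs hm
    -- With `g² = γ` and `r² = |m|`, the hypothesis is `esBeta_mul_abs_le` and the decay is
    -- `|m|^(-3/2)`.
    have h := norm_esArc_sub_jump_le hg0 hg1 hb (r := Real.sqrt |(m : ℝ)|)
      (x := Real.pi * w * (m + κ)) (Real.one_le_sqrt.2 h1) (by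
        rw [Real.sq_sqrt (abs_nonneg _), Real.sq_sqrt hγ0.le]
        exact esBeta_mul_abs_le hσ hγ0 hw hκ hm)
    have e : 1 / Real.sqrt |(m : ℝ)| ^ 3 = |(m : ℝ)| ^ (-(3 / 2 : ℝ)) := by
      rw [Real.rpow_neg (abs_nonneg _), one_div, Real.sqrt_eq_rpow, ← Real.rpow_natCast,
        ← Real.rpow_mul (abs_nonneg _)]
      norm_num
    rw [e] at h
    have e2 : ‖Complex.exp (Complex.I * ((m + κ : ℝ) : ℂ) * (σ * N * x : ℝ))‖ = 1 := by
      rw [mul_assoc, mul_comm, ← Complex.ofReal_mul, Complex.norm_exp_ofReal_mul_I]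
    simp only [hR, if_neg hm]
    rw [norm_mul, e2, mul_one]
    exact h
  have hRT := hT.mul_left (remainderConst (Real.sqrt γ) (esBeta σ γ w))
  have hRs : Summable R := Summable.of_norm_bounded hRT hRb
  have hRn := tsum_of_norm_bounded hRT.hasSum hRb
  rw [tsum_mul_left] at hRn
  refine ⟨kernelScale N σ γ w * (l + ∑' m, R m), ?_, ?_⟩
  · refine (congrArg (fun f => HasSum f _ _) (funext fun m => ?_)).mpr
      ((hl.add (hRs.hasSum.mono_left
        (SummationFilter.symmetricIcc ℤ).le_atTop)).mul_left (kernelScale N σ γ w : ℂ))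
    by_cases hm : m = 0
    · simp [hm, aliasTerm, hR]
    simp only [aliasTerm, if_neg hm, hR]
    rw [fourierHat_nufftKernel hN hσ hw]
    have e1 : Real.pi * w / (σ * N) * (k + m * (σ * N)) = Real.pi * w * (m + κ) := by
      rw [hκdef]
      field_simp
      ring
    have e2 : Complex.exp (Complex.I * ((k + m * (σ * N) : ℝ) : ℂ) * x) =
        Complex.exp (Complex.I * ((m + κ : ℝ) : ℂ) * (σ * N * x : ℝ)) := by
      have : (k : ℝ) = κ * (σ * N) := by
        rw [hκdef]
        field_simp
      rw [this]
      congr 1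
      push_cast
      ring
    rw [e1, e2]
    ring
  · rw [norm_mul, Complex.norm_real, Real.norm_of_nonneg (kernelScale_pos hN hσ hw).le]
    refine mul_le_mul_of_nonneg_left ?_ (kernelScale_pos hN hσ hw).le
    exact (norm_add_le _ _).trans (add_le_add hlb hRn)

/-! ### The rate and the final estimate. -/

/-- The quantity under the square root in the convergence rate. -/
def rateRadicand (σ γ : ℝ) : ℝ :=
  1 - 1 / σ - ((γ ^ 2)⁻¹ - 1) / (4 * σ ^ 2)

lemma kernelScale_mul_arcMass_le (hN : 0 < N) (hσ : 1 < σ) (hγ0 : 0 < γ)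
    (hrad : 0 ≤ rateRadicand σ γ) {w : ℝ} (hw : 0 < w) {k : ℤ} (hk : k ∈ centralModes N) :
    kernelScale N σ γ w * arcMass (Real.pi * w * γ * Real.sqrt (rateRadicand σ γ)) ≤
      ‖fourierHat (nufftKernel N σ γ w) k‖ := by
  have hp := Real.pi_pos
  have hs := kernelScale_pos (γ := γ) hN hσ hw
  have hb := esBeta_pos hσ hγ0 hw
  have hκ := abs_div_le_of_mem_centralModes hN hσ hk
  rw [fourierHat_nufftKernel hN hσ hw, norm_mul, Complex.norm_real, Real.norm_of_nonneg hs.le]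
  refine mul_le_mul_of_nonneg_left ?_ hs.le
  set x := Real.pi * w / (σ * N) * k with hx
  have hxa : x ^ 2 ≤ (Real.pi * w * (1 / (2 * σ))) ^ 2 := by
    have : x = Real.pi * w * (k / (σ * N)) := by rw [hx]; ring
    rw [this, mul_pow (Real.pi * w), mul_pow (Real.pi * w), ← sq_abs (k / (σ * N) : ℝ)]
    gcongr
  have hD : (Real.pi * w * γ * Real.sqrt (rateRadicand σ γ)) ^ 2 ≤ esBeta σ γ w ^ 2 - x ^ 2 := by
    -- The outermost modes `|k| = N/2` minimise `b² - x²`; this identity produces the radicand of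
    -- the rate.
    have e : esBeta σ γ w ^ 2 - (Real.pi * w * (1 / (2 * σ))) ^ 2 =
        (Real.pi * w * γ) ^ 2 * rateRadicand σ γ := by
      unfold esBeta rateRadicand
      field_simp
      ring
    rw [mul_pow, Real.sq_sqrt hrad]
    linarith
  refine (arcMass_le_re_esArc hb ?_ (by positivity) hD).trans (Complex.re_le_norm _)
  exact abs_le_of_sq_le_sq (by nlinarith [sq_nonneg (Real.pi * w * γ *
    Real.sqrt (rateRadicand σ γ))]) hb.le

lemma epsInf_le_epsBound {w : ℝ}
    (h : ∀ k ∈ centralModes N, fourierHat (nufftKernel N σ γ w) (k : ℝ) ≠ 0) :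
    epsInf N σ γ w ≤ epsBound N σ γ w := by
  refine iSup₂_le fun k hk => iSup_le fun x => ?_
  rw [aliasError, enorm_mul, enorm_inv (h k hk), mul_comm, epsBound, div_eq_mul_inv]
  refine mul_le_mul' ?_ (ENNReal.inv_le_inv.2 (iInf₂_le k hk))
  exact (le_iSup (fun x => ‖aliasSum N σ γ w k x‖ₑ) x).trans
    (le_iSup₂ (f := fun k _ => ⨆ x, ‖aliasSum N σ γ w k x‖ₑ) k hk)

lemma epsBound_le_of_bounds {w X Y : ℝ} (hY : 0 < Y)
    (hX : ∀ k ∈ centralModes N, ∀ x, ‖aliasSum N σ γ w k x‖ ≤ X)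
    (hYk : ∀ k ∈ centralModes N, Y ≤ ‖fourierHat (nufftKernel N σ γ w) k‖) :
    epsBound N σ γ w ≤ ENNReal.ofReal (X / Y) := by
  rw [ENNReal.ofReal_div_of_pos hY]
  refine ENNReal.div_le_div (iSup₂_le fun k hk => iSup_le fun x => ?_)
    (le_iInf₂ fun k hk => ?_)
  · rw [← ofReal_norm]
    exact ENNReal.ofReal_le_ofReal (hX k hk x)
  · rw [← ofReal_norm]
    exact ENNReal.ofReal_le_ofReal (hYk k hk)

lemma exists_epsBound_le (hN : 0 < N) (hσ : 1 < σ) (hγ0 : 0 < γ) (hγ1 : γ < 1)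
    (hrad : 0 ≤ rateRadicand σ γ) :
    ∃ C : ℝ, ∀ w : ℝ, 1 ≤ w →
      (∀ k ∈ centralModes N, fourierHat (nufftKernel N σ γ w) (k : ℝ) ≠ 0) ∧
      epsBound N σ γ w ≤ ENNReal.ofReal (C * esRate σ γ w) := by
  obtain ⟨C, T, hCT⟩ := exists_hasSum_aliasTerm hN hσ hγ0 hγ1
  have hp := Real.pi_pos
  set d : ℝ := Real.pi * γ * Real.sqrt (rateRadicand σ γ) with hd
  set c : ℝ := 2 * Real.cos 1 * Real.exp (-(d / 2)) with hc
  have hcpos : 0 < c := by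
    have := Real.cos_one_pos
    positivity
  set A : ℝ := |C| + remainderConst (Real.sqrt γ) (esBeta σ γ 1) * |T| with hA
  refine ⟨A / c, fun w hw => ?_⟩
  have hw0 : 0 < w := by linarith
  have hs := kernelScale_pos (γ := γ) hN hσ hw0
  set D : ℝ := Real.pi * w * γ * Real.sqrt (rateRadicand σ γ) with hD
  have hsq : 1 ≤ Real.sqrt w := Real.one_le_sqrt.2 hw
  -- Here `s = 1 / √w`, so that `D s² = d` does not depend on `w`; this is the source of the factor
  -- `√w` in the rate.
  have hm : c * ((Real.sqrt w)⁻¹ * Real.exp D) ≤ arcMass D := by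
    refine le_arcMass (by positivity) (by positivity) (inv_le_one_of_one_le₀ hsq) (le_of_eq ?_)
    rw [inv_pow, Real.sq_sqrt hw0.le, hD, hd]
    field_simp
  have hY : ∀ k ∈ centralModes N, kernelScale N σ γ w * (c * ((Real.sqrt w)⁻¹ * Real.exp D)) ≤
      ‖fourierHat (nufftKernel N σ γ w) k‖ := fun k hk =>
    (mul_le_mul_of_nonneg_left hm hs.le).trans
      (kernelScale_mul_arcMass_le hN hσ hγ0 hrad hw0 hk)
  have hY0 : 0 < kernelScale N σ γ w * (c * ((Real.sqrt w)⁻¹ * Real.exp D)) := by positivity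
  refine ⟨fun k hk => norm_pos_iff.1 (hY0.trans_le (hY k hk)), ?_⟩
  have hX : ∀ k ∈ centralModes N, ∀ x, ‖aliasSum N σ γ w k x‖ ≤ kernelScale N σ γ w * A := by
    intro k hk x
    obtain ⟨l, hl, hlb⟩ := hCT w hw0 k hk x
    rw [aliasSum, hl.tsum_eq]
    refine hlb.trans (mul_le_mul_of_nonneg_left ?_ hs.le)
    have hg0 : 0 < Real.sqrt γ := Real.sqrt_pos.2 hγ0
    have hg1 : Real.sqrt γ < 1 := by rw [Real.sqrt_lt' one_pos]; linarith
    have hb1 := esBeta_pos hσ hγ0 one_pos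
    have hbw : esBeta σ γ 1 ≤ esBeta σ γ w := by
      have e : esBeta σ γ w = w * esBeta σ γ 1 := by unfold esBeta; ring
      rw [e]
      nlinarith
    have hr0 : 0 ≤ remainderConst (Real.sqrt γ) (esBeta σ γ w) := by
      have := esBeta_pos hσ hγ0 hw0
      have : 0 < 1 - Real.sqrt γ := by linarith
      unfold remainderConst
      positivity
    refine add_le_add ?_ ?_
    · exact (div_le_div_of_nonneg_right (le_abs_self C) hw0.le).trans
        (div_le_self (abs_nonneg C) hw)
    · exact (mul_le_mul_of_nonneg_left (le_abs_self T) hr0).trans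
        (mul_le_mul_of_nonneg_right (remainderConst_anti hg0 hg1 hb1 hbw) (abs_nonneg T))
  refine (epsBound_le_of_bounds hY0 hX hY).trans_eq ?_
  congr 1
  have e : esRate σ γ w = Real.sqrt w * (Real.exp D)⁻¹ := by
    rw [esRate, ← Real.exp_neg]
    rfl
  rw [e]
  field_simp

end

end

theorem theorem1 (N : ℕ) (hN : 0 < N) (σ γ : ℝ) (hσ : 1 < σ) (hγ0 : 0 < γ) (hγ1 : γ < 1)
    (hrad : 0 ≤ 1 - 1 / σ - ((γ ^ 2)⁻¹ - 1) / (4 * σ ^ 2)) :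
    (∀ w : ℝ, 0 < w → ∀ k ∈ centralModes N, ∀ x : ℝ,
      Summable (aliasTerm N σ γ w k x) (SummationFilter.symmetricIcc ℤ)) ∧
    (∀ᶠ w : ℝ in atTop,
      (∀ k ∈ centralModes N, fourierHat (nufftKernel N σ γ w) (k : ℝ) ≠ 0) ∧
      epsInf N σ γ w ≤ epsBound N σ γ w ∧ epsBound N σ γ w ≠ ⊤) ∧
    (fun w : ℝ => (epsInf N σ γ w).toReal) =O[atTop] (fun w : ℝ => esRate σ γ w) ∧
    (fun w : ℝ => (epsBound N σ γ w).toReal) =O[atTop] (fun w : ℝ => esRate σ γ w) := by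
  obtain ⟨C, T, hCT⟩ := exists_hasSum_aliasTerm hN hσ hγ0 hγ1
  obtain ⟨B, hB⟩ := exists_epsBound_le hN hσ hγ0 hγ1 hrad
  have hO : ∀ u : ℝ → ENNReal, (∀ w, 1 ≤ w → u w ≤ ENNReal.ofReal (B * esRate σ γ w)) →
      (fun w : ℝ => (u w).toReal) =O[atTop] (fun w : ℝ => esRate σ γ w) := by
    intro u hu
    refine IsBigO.of_bound |B| ?_
    filter_upwards [eventually_ge_atTop 1] with w hw
    rw [Real.norm_of_nonneg ENNReal.toReal_nonneg, Real.norm_eq_abs, ← abs_mul]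
    exact ENNReal.toReal_le_of_le_ofReal (abs_nonneg _)
      ((hu w hw).trans (ENNReal.ofReal_le_ofReal (le_abs_self _)))
  refine ⟨fun w hw k hk x => ?_, ?_, hO _ fun w hw => ?_, hO _ fun w hw => (hB w hw).2⟩
  · obtain ⟨l, hl, -⟩ := hCT w hw k hk x
    exact hl.summable
  · filter_upwards [eventually_ge_atTop 1] with w hw
    obtain ⟨h1, h2⟩ := hB w hw
    exact ⟨h1, epsInf_le_epsBound h1, ne_top_of_le_ne_top ENNReal.ofReal_ne_top h2⟩
  · exact (epsInf_le_epsBound (hB w hw).1).trans (hB w hw).2
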